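/- Throughout, $\mathcal H$ is a complex Hilbert space with inner product $\langle\cdot,\cdot\rangle$, and $X\le Y$ for bounded self-adjoint operators means that $Y-X$ is positive; $X>0$ means that $X$ is strictly positive, i.e. positive and invertible. Functions of operators are taken in the continuous functional calculus. A continuous function $f:(0,\infty)\to\mathbb R$ is called operator monotone if $X\le Y$ implies $f(X)\le f(Y)$ for all strictly positive bounded operators $X,Y$ on every complex Hilbert space. For $\alpha\in[0,1]$ and strictly positive $X,Y$, the weighted geometric mean is $$X\,\sharp_\alpha\,Y=X^{1/2}\left(X^{-1/2}YX^{-1/2}\right)^{\alpha}X^{1/2},$$ with the convention $0\,\sharp_\alpha\,0=0$ (needed only for $f\equiv 0$). The Kantorovich constant is $K(h)=\dfrac{(h+1)^2}{4h}$ for $h>0$. **Theorem.** Let $f$ be a non-negative operator monotone function on $(0,\infty)$, let $p,q>1$ be real numbers with $\frac1p+\frac1q=1$, and let $A,B$ be positive bounded operators on $\mathcal H$ with $0<sA^p\le B^q\le tA^p$ for some real scalars $0<s\le t$. Put $R=\max\left\{\frac1p,\frac1q\right\}$ and $c=\max\{K(s)^R,K(t)^R\}$. Then $$f\left(A^p\,\sharp_{1/q}\,B^q\right)\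 \ge\ \frac1c\;f(A^p)\,\sharp_{1/q}\,f(B^q),$$ and, for all $x\in\mathcal H$, $$\left\langle f\left(A^p\,\sharp_{1/q}\,B^q\right)x,x\right\rangle\ \ge\ \frac1c\,\left\langle f(A^p)x,x\right\rangle^{1/p}\left\langle f(B^q)x,x\right\rangle^{1/q}.$$ -/

import Mathlib

universe u

/-- A real function `f` is operator monotone on `(0, ∞)`: it is continuous there, and
`A ≤ B` implies `f(A) ≤ f(B)` for all strictly positive (that is, positive and invertible)
bounded operators `A`, `B` on every complex Hilbert space. Here `≤` is the Loewner order and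
`f(A)` is the continuous functional calculus. -/
def OperatorMonotone (f : ℝ → ℝ) : Prop :=
  ContinuousOn f (Set.Ioi 0) ∧
    ∀ (K : Type u) [NormedAddCommGroup K] [InnerProductSpace ℂ K] [CompleteSpace K]
      (A B : K →L[ℂ] K), IsStrictlyPositive A → IsStrictlyPositive B →
        A ≤ B → cfc f A ≤ cfc f B

/-- The weighted geometric mean
`A ♯_α B = A^{1/2} (A^{-1/2} B A^{-1/2})^α A^{1/2}` of positive operators. -/
noncomputable def operatorGeomMean {H : Type*} [NormedAddCommGroup H] [InnerProductSpace ℂ H]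
    [CompleteSpace H] (α : ℝ) (A B : H →L[ℂ] H) : H →L[ℂ] H :=
  A ^ (1 / 2 : ℝ) * (A ^ (-(1 / 2) : ℝ) * B * A ^ (-(1 / 2) : ℝ)) ^ α * A ^ (1 / 2 : ℝ)

/-- The Kantorovich constant `K(h) = (h + 1)² / (4h)`, for `h > 0`. -/
noncomputable def kantorovich (h : ℝ) : ℝ := (h + 1) ^ 2 / (4 * h)

/-- The constant `max {K(s)^R, K(t)^R}` with `R = max {1/p, 1/q}`. -/
noncomputable def aczelConst (p q s t : ℝ) : ℝ :=
  max (kantorovich s ^ max (1 / p) (1 / q)) (kantorovich t ^ max (1 / p) (1 / q))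

/-! Write P = A^p, Q = B^q, α = 1/q. Both claims follow from one inequality,
`OperatorMonotone.arith_cfc_le`: (1-α) f(P) + α f(Q) ≤ c f(P ♯ Q). Bounding the left side below by
the operator AM-GM inequality gives the first claim; scalar AM-GM for the quadratic forms gives the
second.

That inequality joins three facts. The spectrum of P^{-1/2} Q P^{-1/2} lies in [s, t], so a scalar
reverse Young inequality gives (1-α)P + αQ ≤ c (P ♯ Q). Monotonicity makes f operator concave, up to
a factor 1+ε in the argument (`OperatorMonotone.smul_add_smul_le`). Concavity and f ≥ 0 give f(cX) ≤
c f(X) for c ≥ 1. Finally ε → 0. -/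

open ContinuousLinearMap

/-! ### Quadratic forms and the Loewner order. -/

section QuadraticForm

variable {H : Type*} [NormedAddCommGroup H] [InnerProductSpace ℂ H]

lemma ContinuousLinearMap.reApplyInnerSelf_add (S T : H →L[ℂ] H) (x : H) :
    (S + T).reApplyInnerSelf x = S.reApplyInnerSelf x + T.reApplyInnerSelf x := by
  simp [reApplyInnerSelf_apply, inner_add_left]

lemma ContinuousLinearMap.reApplyInnerSelf_real_smul (r : ℝ) (T : H →L[ℂ] H) (x : H) :
    (r • T).reApplyInnerSelf x = r * T.reApplyInnerSelf x := by
  rw [reApplyInnerSelf_apply, smul_apply, RCLike.real_smul_eq_coe_smul (K := ℂ), inner_smul_left]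
  simp [reApplyInnerSelf_apply]

lemma ContinuousLinearMap.reApplyInnerSelf_ofReal_smul_apply (T : H →L[ℂ] H) (r : ℝ) (x : H) :
    T.reApplyInnerSelf ((r : ℂ) • x) = r ^ 2 * T.reApplyInnerSelf x := by
  rw [reApplyInnerSelf_smul]
  simp

lemma ContinuousLinearMap.reApplyInnerSelf_one (x : H) :
    (1 : H →L[ℂ] H).reApplyInnerSelf x = ‖x‖ ^ 2 := by
  simp [reApplyInnerSelf_apply, ← Complex.ofReal_pow]

lemma ContinuousLinearMap.reApplyInnerSelf_mono [CompleteSpace H] {S T : H →L[ℂ] H} (h : S ≤ T)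
    (x : H) : S.reApplyInnerSelf x ≤ T.reApplyInnerSelf x := by
  have := (le_def _ _).1 h |>.2 x
  simpa [reApplyInnerSelf_apply, inner_sub_left] using this

lemma ContinuousLinearMap.le_of_reApplyInnerSelf_le [CompleteSpace H] {S T : H →L[ℂ] H}
    (hS : IsSelfAdjoint S) (hT : IsSelfAdjoint T)
    (h : ∀ x, S.reApplyInnerSelf x ≤ T.reApplyInnerSelf x) : S ≤ T := by
  refine (le_def _ _).2 ⟨(hT.sub hS).isSymmetric, fun x => ?_⟩
  have := h x
  simp only [reApplyInnerSelf_apply] at this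
  simpa [reApplyInnerSelf_apply, inner_sub_left] using this

lemma ContinuousLinearMap.reApplyInnerSelf_le_norm (T : H →L[ℂ] H) (x : H) :
    T.reApplyInnerSelf x ≤ ‖T‖ * ‖x‖ ^ 2 := by
  rw [reApplyInnerSelf_apply]
  calc RCLike.re (inner ℂ (T x) x) ≤ ‖T x‖ * ‖x‖ := re_inner_le_norm _ _
    _ ≤ ‖T‖ * ‖x‖ * ‖x‖ := by gcongr; exact T.le_opNorm x
    _ = _ := by ring

/-- Positivity of T at εx + y, divided by ε, bounds the cross terms. -/
lemma ContinuousLinearMap.reApplyInnerSelf_sub_le [CompleteSpace H] {T : H →L[ℂ] H} (hT : 0 ≤ T)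
    {ε : ℝ} (hε : 0 < ε) (x y : H) :
    T.reApplyInnerSelf (x - y) ≤
      (1 + ε) * T.reApplyInnerSelf x + (1 + 1 / ε) * T.reApplyInnerSelf y := by
  have h := ((nonneg_iff_isPositive _).1 hT).2 ((ε : ℂ) • x + y)
  simp only [reApplyInnerSelf_apply, map_add, map_sub, map_smul, inner_add_left, inner_add_right,
    inner_sub_left, inner_sub_right, inner_smul_left, inner_smul_right, Complex.conj_ofReal,
    RCLike.re_to_complex, Complex.add_re, Complex.re_ofReal_mul] at h ⊢
  have h' : 0 ≤ (1 / ε) * (ε * (ε * (inner ℂ (T x) x).re) + ε * (inner ℂ (T y) x).re +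
      (ε * (inner ℂ (T x) y).re + (inner ℂ (T y) y).re)) := by
    refine mul_nonneg (by positivity) (h.trans_eq (by ring))
  field_simp at h' ⊢
  linarith

end QuadraticForm

/-! ### Block operators and rotations on H ⊕ H. -/

section Block

variable (H : Type*) [NormedAddCommGroup H] [InnerProductSpace ℂ H]

/-- The block diagonal operator on the Hilbert sum of two copies of `H`. -/
noncomputable def blockDiagL (T : (H →L[ℂ] H) × (H →L[ℂ] H)) :
    WithLp 2 (H × H) →L[ℂ] WithLp 2 (H × H) :=
  (WithLp.prodContinuousLinearEquiv 2 ℂ H H).symm ∘L (T.1.prodMap T.2) ∘L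
    (WithLp.prodContinuousLinearEquiv 2 ℂ H H : WithLp 2 (H × H) →L[ℂ] H × H)

variable {H} in
lemma blockDiagL_apply (T : (H →L[ℂ] H) × (H →L[ℂ] H)) (x : WithLp 2 (H × H)) :
    blockDiagL H T x = WithLp.toLp 2 (T.1 x.fst, T.2 x.snd) := rfl

variable [CompleteSpace H]

/-- `blockDiagL` as a star algebra homomorphism. -/
noncomputable def blockDiag :
    ((H →L[ℂ] H) × (H →L[ℂ] H)) →⋆ₐ[ℂ] (WithLp 2 (H × H) →L[ℂ] WithLp 2 (H × H)) where
  toFun := blockDiagL H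
  map_one' := rfl
  map_mul' _ _ := rfl
  map_zero' := rfl
  map_add' _ _ := rfl
  commutes' _ := rfl
  map_star' T := by
    rw [star_eq_adjoint, eq_adjoint_iff]
    intro x y
    simp [blockDiagL_apply, WithLp.prod_inner_apply, star_eq_adjoint, adjoint_inner_left]

variable {H}

lemma blockDiag_apply (T : (H →L[ℂ] H) × (H →L[ℂ] H)) (x : WithLp 2 (H × H)) :
    blockDiag H T x = WithLp.toLp 2 (T.1 x.fst, T.2 x.snd) := rfl

lemma continuous_blockDiag : Continuous (blockDiag H) := by
  have : Continuous fun T : (H →L[ℂ] H) × (H →L[ℂ] H) => T.1.prodMap T.2 :=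
    (ContinuousLinearMap.prodMapL ℂ H H H H).continuous
  change Continuous fun T => blockDiagL H T
  unfold blockDiagL
  fun_prop

lemma reApplyInnerSelf_blockDiag (S T : H →L[ℂ] H) (x : WithLp 2 (H × H)) :
    (blockDiag H (S, T)).reApplyInnerSelf x =
      S.reApplyInnerSelf x.fst + T.reApplyInnerSelf x.snd := by
  simp [reApplyInnerSelf_apply, blockDiag_apply, WithLp.prod_inner_apply]

lemma isSelfAdjoint_blockDiag {S T : H →L[ℂ] H} (hS : IsSelfAdjoint S) (hT : IsSelfAdjoint T) :
    IsSelfAdjoint (blockDiag H (S, T)) :=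
  IsSelfAdjoint.map (show IsSelfAdjoint (S, T) from Prod.ext hS hT) (blockDiag H)

lemma isStrictlyPositive_blockDiag {S T : H →L[ℂ] H} (hS : IsStrictlyPositive S)
    (hT : IsStrictlyPositive T) : IsStrictlyPositive (blockDiag H (S, T)) := by
  refine IsUnit.isStrictlyPositive ?_ ?_
  · exact (Prod.isUnit_iff.2 ⟨hS.isUnit, hT.isUnit⟩).map (blockDiag H)
  · refine le_of_reApplyInnerSelf_le (.zero _)
      (isSelfAdjoint_blockDiag hS.isSelfAdjoint hT.isSelfAdjoint) fun x => ?_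
    have h1 := reApplyInnerSelf_mono hS.nonneg x.fst
    have h2 := reApplyInnerSelf_mono hT.nonneg x.snd
    rw [reApplyInnerSelf_blockDiag]
    simp only [reApplyInnerSelf_apply, zero_apply, inner_zero_left, map_zero] at *
    positivity

lemma IsStrictlyPositive.continuousOn_spectrum {A : Type*} [Ring A] [PartialOrder A] [Algebra ℝ A]
    [NonnegSpectrumClass ℝ A] {a : A} (ha : IsStrictlyPositive a) {f : ℝ → ℝ}
    (hf : ContinuousOn f (Set.Ioi 0)) : ContinuousOn f (spectrum ℝ a) :=
  hf.mono fun _ hx => ha.spectrum_pos hx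

lemma cfc_blockDiag {f : ℝ → ℝ} (hf : ContinuousOn f (Set.Ioi 0)) {S T : H →L[ℂ] H}
    (hS : IsStrictlyPositive S) (hT : IsStrictlyPositive T) :
    cfc f (blockDiag H (S, T)) = blockDiag H (cfc f S, cfc f T) := by
  have : ContinuousFunctionalCalculus ℝ ((H →L[ℂ] H) × (H →L[ℂ] H)) IsSelfAdjoint :=
    IsSelfAdjoint.instContinuousFunctionalCalculus (A := (H →L[ℂ] H) × (H →L[ℂ] H))
  have hST : ContinuousOn f (spectrum ℝ S ∪ spectrum ℝ T) :=
    hf.mono (Set.union_subset (fun _ h => hS.spectrum_pos h) fun _ h => hT.spectrum_pos h)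
  have hsa : IsSelfAdjoint (S, T) := Prod.ext hS.isSelfAdjoint hT.isSelfAdjoint
  rw [← cfc_map_prod (S := ℝ) f S T hST hsa hS.isSelfAdjoint hT.isSelfAdjoint]
  exact ((blockDiag H).map_cfc f (S, T) (by rwa [Prod.spectrum_eq]) continuous_blockDiag hsa
    (isSelfAdjoint_blockDiag hS.isSelfAdjoint hT.isSelfAdjoint)).symm

/-- The operator `(x, y) ↦ (a x - b y, b x + a y)`. -/
noncomputable def blockRot (H : Type*) [NormedAddCommGroup H] [InnerProductSpace ℂ H] (a b : ℝ) :
    WithLp 2 (H × H) →L[ℂ] WithLp 2 (H × H) :=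
  (WithLp.prodContinuousLinearEquiv 2 ℂ H H).symm ∘L
    (((a : ℂ) • WithLp.fstL 2 ℂ H H - (b : ℂ) • WithLp.sndL 2 ℂ H H).prod
      ((b : ℂ) • WithLp.fstL 2 ℂ H H + (a : ℂ) • WithLp.sndL 2 ℂ H H))

omit [CompleteSpace H] in
lemma blockRot_apply (a b : ℝ) (x : WithLp 2 (H × H)) :
    blockRot H a b x = WithLp.toLp 2
      ((a : ℂ) • x.fst - (b : ℂ) • x.snd, (b : ℂ) • x.fst + (a : ℂ) • x.snd) := rfl

lemma star_blockRot (a b : ℝ) : star (blockRot H a b) = blockRot H a (-b) := by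
  rw [star_eq_adjoint, eq_comm, eq_adjoint_iff]
  intro x y
  simp only [blockRot_apply, WithLp.prod_inner_apply, inner_add_left, inner_add_right,
    inner_sub_left, inner_sub_right, inner_smul_left, inner_smul_right, Complex.conj_ofReal,
    Complex.ofReal_neg, WithLp.fst, WithLp.snd, map_neg]
  ring

omit [CompleteSpace H] in
lemma blockRot_mul_blockRot_neg {a b : ℝ} (hab : a ^ 2 + b ^ 2 = 1) :
    blockRot H a b * blockRot H a (-b) = 1 := by
  have h : (a : ℂ) ^ 2 + (b : ℂ) ^ 2 = 1 := by exact_mod_cast hab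
  ext1 x
  change WithLp.toLp 2
    ((a : ℂ) • ((a : ℂ) • x.fst - ((-b : ℝ) : ℂ) • x.snd) -
        (b : ℂ) • (((-b : ℝ) : ℂ) • x.fst + (a : ℂ) • x.snd),
      (b : ℂ) • ((a : ℂ) • x.fst - ((-b : ℝ) : ℂ) • x.snd) +
        (a : ℂ) • (((-b : ℝ) : ℂ) • x.fst + (a : ℂ) • x.snd)) = x
  apply WithLp.ofLp_injective
  push_cast
  refine Prod.ext ?_ ?_
  · change _ - _ = x.fst
    linear_combination (norm := module) h • x.fst
  · change _ + _ = x.snd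
    linear_combination (norm := module) h • x.snd

lemma star_blockRot_apply_blockRot {a b : ℝ} (hab : a ^ 2 + b ^ 2 = 1) (x : WithLp 2 (H × H)) :
    star (blockRot H a b) (blockRot H a b x) = x := by
  have := congr($(blockRot_mul_blockRot_neg (H := H) (a := a) (b := -b) (by simpa using hab)) x)
  rw [neg_neg] at this
  rw [star_blockRot]
  exact this

end Block

/-! ### Operator concavity from operator monotonicity. -/

section Jensen

variable {H : Type u} [NormedAddCommGroup H] [InnerProductSpace ℂ H] [CompleteSpace H]

/-- The unitary `(x, y) ↦ (a x - b y, b x + a y)` for `a² + b² = 1`. -/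
noncomputable def blockRotUnitary (H : Type*) [NormedAddCommGroup H] [InnerProductSpace ℂ H]
    [CompleteSpace H] {a b : ℝ} (hab : a ^ 2 + b ^ 2 = 1) :
    unitary (WithLp 2 (H × H) →L[ℂ] WithLp 2 (H × H)) :=
  ⟨blockRot H a b, by
    rw [Unitary.mem_iff, star_blockRot]
    refine ⟨?_, blockRot_mul_blockRot_neg hab⟩
    simpa using blockRot_mul_blockRot_neg (H := H) (a := a) (b := -b) (by simpa using hab)⟩

lemma Unitary.cfc_conj {K : Type*} [NormedAddCommGroup K] [InnerProductSpace ℂ K]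
    [CompleteSpace K] (U : unitary (K →L[ℂ] K)) {f : ℝ → ℝ} {T : K →L[ℂ] K}
    (hT : IsSelfAdjoint T) (hf : ContinuousOn f (spectrum ℝ T)) :
    cfc f ((U : K →L[ℂ] K) * T * star (U : K →L[ℂ] K)) =
      (U : K →L[ℂ] K) * cfc f T * star (U : K →L[ℂ] K) := by
  have := StarAlgHomClass.map_cfc (S := ℂ) (Unitary.conjStarAlgAut ℂ (K →L[ℂ] K) U) f T hf
    (by
      change Continuous fun x => (U : K →L[ℂ] K) * x * star (U : K →L[ℂ] K)
      fun_prop) hT (hT.map _)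
  exact this.symm

lemma reApplyInnerSelf_conj {K : Type*} [NormedAddCommGroup K] [InnerProductSpace ℂ K]
    [CompleteSpace K] (U T : K →L[ℂ] K) (x : K) :
    (U * T * star U).reApplyInnerSelf x = T.reApplyInnerSelf (star U x) := by
  rw [reApplyInnerSelf_apply, reApplyInnerSelf_apply, star_eq_adjoint]
  change RCLike.re (inner ℂ (U (T (adjoint U x))) x) = _
  rw [← adjoint_inner_right]

/-- In rotated coordinates diag(P, Q) has corner a²P + b²Q. The off-diagonal blocks are absorbed at
the cost of ε in that corner and a large scalar in the other; the extra +1 keeps that scalar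
strictly positive. -/
lemma blockDiag_le_conj {P Q : H →L[ℂ] H} (hP : 0 ≤ P) (hQ : 0 ≤ Q) {a b : ℝ}
    (hab : a ^ 2 + b ^ 2 = 1) {ε : ℝ} (hε : 0 < ε) :
    blockDiag H (P, Q) ≤ blockRot H a b *
      blockDiag H ((1 + ε) • (a ^ 2 • P + b ^ 2 • Q),
        ((1 + 1 / ε) * (‖P‖ + ‖Q‖) + 1) • (1 : H →L[ℂ] H)) * star (blockRot H a b) := by
  have hPsa : IsSelfAdjoint P := .of_nonneg hP
  have hQsa : IsSelfAdjoint Q := .of_nonneg hQ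
  refine le_of_reApplyInnerSelf_le (isSelfAdjoint_blockDiag hPsa hQsa) ?_ fun w => ?_
  · refine IsSelfAdjoint.conjugate (isSelfAdjoint_blockDiag ?_ ?_) _
    · exact (IsSelfAdjoint.all (1 + ε)).smul
        (((IsSelfAdjoint.all _).smul hPsa).add ((IsSelfAdjoint.all _).smul hQsa))
    · exact (IsSelfAdjoint.all _).smul (.one _)
  obtain ⟨z, rfl⟩ : ∃ z, w = blockRot H a b z := by
    refine ⟨blockRot H a (-b) w, ?_⟩
    have := congr($(blockRot_mul_blockRot_neg (H := H) hab) w)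
    exact this.symm
  rw [reApplyInnerSelf_conj, star_blockRot_apply_blockRot hab,
    reApplyInnerSelf_blockDiag, reApplyInnerSelf_blockDiag, blockRot_apply]
  set x := z.fst
  set y := z.snd
  change P.reApplyInnerSelf ((a : ℂ) • x - (b : ℂ) • y) +
    Q.reApplyInnerSelf ((b : ℂ) • x + (a : ℂ) • y) ≤ _
  have h1 := reApplyInnerSelf_sub_le hP hε ((a : ℂ) • x) ((b : ℂ) • y)
  -- The sign of a is flipped so that the sum bx + ay fits the bound for differences.
  have h2 := reApplyInnerSelf_sub_le hQ hε ((b : ℂ) • x) (((-a : ℝ) : ℂ) • y)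
  have h3 : (b : ℂ) • x - ((-a : ℝ) : ℂ) • y = (b : ℂ) • x + (a : ℂ) • y := by
    push_cast; module
  rw [h3] at h2
  have hPy := reApplyInnerSelf_le_norm P y
  have hQy := reApplyInnerSelf_le_norm Q y
  simp only [reApplyInnerSelf_ofReal_smul_apply] at h1 h2
  simp only [reApplyInnerSelf_real_smul, reApplyInnerSelf_add, reApplyInnerSelf_one]
  have hbP : b ^ 2 * P.reApplyInnerSelf y ≤ ‖P‖ * ‖y‖ ^ 2 :=
    calc b ^ 2 * P.reApplyInnerSelf y ≤ b ^ 2 * (‖P‖ * ‖y‖ ^ 2) := by gcongr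
      _ ≤ 1 * (‖P‖ * ‖y‖ ^ 2) := by gcongr; linarith [sq_nonneg a]
      _ = _ := one_mul _
  have haQ : (-a) ^ 2 * Q.reApplyInnerSelf y ≤ ‖Q‖ * ‖y‖ ^ 2 :=
    calc (-a) ^ 2 * Q.reApplyInnerSelf y ≤ (-a) ^ 2 * (‖Q‖ * ‖y‖ ^ 2) := by gcongr
      _ ≤ 1 * (‖Q‖ * ‖y‖ ^ 2) := by gcongr; linarith [sq_nonneg b]
      _ = _ := one_mul _
  have h4 := mul_le_mul_of_nonneg_left (add_le_add hbP haQ) (by positivity : 0 ≤ 1 + 1 / ε)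
  linarith [sq_nonneg ‖y‖]

/-- An operator monotone function satisfies Jensen's operator inequality up to an arbitrarily
small dilation of the mean. -/
lemma OperatorMonotone.smul_add_smul_le {f : ℝ → ℝ} (hf : OperatorMonotone.{u} f)
    {P Q : H →L[ℂ] H} (hP : IsStrictlyPositive P) (hQ : IsStrictlyPositive Q) {μ ν : ℝ}
    (hμ : 0 < μ) (hν : 0 < ν) (hμν : μ + ν = 1) {ε : ℝ} (hε : 0 < ε) :
    μ • cfc f P + ν • cfc f Q ≤ cfc f ((1 + ε) • (μ • P + ν • Q)) := by
  obtain ⟨a, rfl⟩ : ∃ a, μ = a ^ 2 := ⟨√μ, (Real.sq_sqrt hμ.le).symm⟩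
  obtain ⟨b, rfl⟩ : ∃ b, ν = b ^ 2 := ⟨√ν, (Real.sq_sqrt hν.le).symm⟩
  have hX : IsStrictlyPositive ((1 + ε) • (a ^ 2 • P + b ^ 2 • Q)) :=
    .smul (by positivity) ((hP.smul hμ).add_nonneg (hQ.smul hν).nonneg)
  have hM : IsStrictlyPositive (((1 + 1 / ε) * (‖P‖ + ‖Q‖) + 1) • (1 : H →L[ℂ] H)) :=
    .smul (by positivity) isStrictlyPositive_one
  have hle := blockDiag_le_conj hP.nonneg hQ.nonneg hμν hε
  have hD := isStrictlyPositive_blockDiag hX hM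
  have hmono := hf.2 _ _ _ (isStrictlyPositive_blockDiag hP hQ)
    ((isStrictlyPositive_blockDiag hP hQ).of_le hle) hle
  have hconj := Unitary.cfc_conj (blockRotUnitary H hμν) hD.isSelfAdjoint
    (hD.continuousOn_spectrum hf.1)
  change cfc f (blockRot H a b * _ * star (blockRot H a b)) =
    blockRot H a b * _ * star (blockRot H a b) at hconj
  rw [hconj, cfc_blockDiag hf.1 hP hQ, cfc_blockDiag hf.1 hX hM] at hmono
  refine le_of_reApplyInnerSelf_le ?_ (cfc_predicate _ _) fun x => ?_
  · exact ((IsSelfAdjoint.all _).smul (cfc_predicate _ _)).add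
      ((IsSelfAdjoint.all _).smul (cfc_predicate _ _))
  -- The rotated vector (x, 0) kills the large scalar block on the right and becomes (ax, bx) on the
  -- left.
  have h := reApplyInnerSelf_mono hmono (blockRot H a b (WithLp.toLp 2 (x, 0)))
  rw [reApplyInnerSelf_conj, star_blockRot_apply_blockRot hμν,
    reApplyInnerSelf_blockDiag, reApplyInnerSelf_blockDiag, blockRot_apply] at h
  simp only [smul_zero, sub_zero, add_zero, WithLp.toLp_fst, WithLp.toLp_snd,
    reApplyInnerSelf_ofReal_smul_apply] at h
  rw [reApplyInnerSelf_add, reApplyInnerSelf_real_smul, reApplyInnerSelf_real_smul]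
  simpa [reApplyInnerSelf_apply] using h

end Jensen

/-! ### Scalar inequalities for the Kantorovich constant. -/

section Scalar

lemma one_le_kantorovich {x : ℝ} (hx : 0 < x) : 1 ≤ kantorovich x := by
  rw [kantorovich, le_div_iff₀ (by positivity)]
  nlinarith [sq_nonneg (x - 1)]

/-- K decreases on (0, 1] and increases on [1, ∞): K(x) - K(y) has the sign of (x - y)(xy - 1). -/
lemma kantorovich_le_max {s t x : ℝ} (hs : 0 < s) (hsx : s ≤ x) (hxt : x ≤ t) :
    kantorovich x ≤ max (kantorovich s) (kantorovich t) := by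
  have hx : 0 < x := hs.trans_le hsx
  have ht : 0 < t := hx.trans_le hxt
  rcases le_total x 1 with h | h
  · refine le_max_of_le_left ?_
    have : s * x ≤ 1 := mul_le_one₀ (hsx.trans h) hx.le h
    rw [kantorovich, kantorovich, div_le_div_iff₀ (by positivity) (by positivity)]
    nlinarith [mul_nonneg (sub_nonneg.2 hsx) (sub_nonneg.2 this)]
  · refine le_max_of_le_right ?_
    have : 1 ≤ x * t := one_le_mul_of_one_le_of_one_le h (h.trans hxt)
    rw [kantorovich, kantorovich, div_le_div_iff₀ (by positivity) (by positivity)]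
    nlinarith [mul_nonneg (sub_nonneg.2 hxt) (sub_nonneg.2 this)]

/-- Since K(x)x = ((1 + x)/2)², this is Bernoulli's inequality with exponent 2α ≥ 1. -/
lemma add_mul_le_kantorovich_rpow_mul_rpow_of_half_le {α x : ℝ} (hα : 1 / 2 ≤ α) (hx : 0 < x) :
    (1 - α) + α * x ≤ kantorovich x ^ α * x ^ α := by
  have h := one_add_mul_self_le_rpow_one_add (s := (x - 1) / 2) (by linarith) (p := 2 * α)
    (by linarith)
  have hK : kantorovich x * x = (1 + (x - 1) / 2) ^ 2 := by
    rw [kantorovich]; field_simp; ring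
  rw [← Real.mul_rpow (zero_le_one.trans (one_le_kantorovich hx)) hx.le, hK,
    ← Real.rpow_natCast, ← Real.rpow_mul (by linarith)]
  push_cast
  linarith

/-- The reverse weighted arithmetic-geometric mean inequality with the Kantorovich constant. -/
lemma add_mul_le_kantorovich_rpow_mul_rpow {α x : ℝ} (hx : 0 < x) :
    (1 - α) + α * x ≤ kantorovich x ^ max (1 - α) α * x ^ α := by
  rcases le_total (1 - α) α with h | h
  · rw [max_eq_right h]
    exact add_mul_le_kantorovich_rpow_mul_rpow_of_half_le (by linarith) hx
  · rw [max_eq_left h]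
    -- Replacing x by 1/x swaps the weights and leaves K unchanged.
    have h1 := add_mul_le_kantorovich_rpow_mul_rpow_of_half_le (α := 1 - α) (by linarith)
      (inv_pos.2 hx)
    have hK : kantorovich x⁻¹ = kantorovich x := by
      rw [kantorovich, kantorovich]; field_simp; ring
    rw [hK] at h1
    calc (1 - α) + α * x = (1 - (1 - α) + (1 - α) * x⁻¹) * x := by field_simp; ring
      _ ≤ (kantorovich x ^ (1 - α) * x⁻¹ ^ (1 - α)) * x := by gcongr
      _ = kantorovich x ^ (1 - α) * x ^ α := by
        rw [Real.inv_rpow hx.le, ← Real.rpow_neg hx.le, mul_assoc, ← Real.rpow_add_one hx.ne']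
        congr 2; ring

lemma add_mul_le_max_kantorovich_rpow_mul_rpow {α s t x : ℝ} (hs : 0 < s) (hsx : s ≤ x)
    (hxt : x ≤ t) :
    (1 - α) + α * x ≤
      max (kantorovich s ^ max (1 - α) α) (kantorovich t ^ max (1 - α) α) * x ^ α := by
  have hx : 0 < x := hs.trans_le hsx
  have hK := zero_le_one.trans (one_le_kantorovich hx)
  have hR : 0 ≤ max (1 - α) α := by
    rcases le_total 0 α with h | h
    · exact le_max_of_le_right h
    · exact le_max_of_le_left (by linarith)
  refine (add_mul_le_kantorovich_rpow_mul_rpow hx).trans ?_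
  gcongr
  rcases le_max_iff.1 (kantorovich_le_max hs hsx hxt) with h | h
  · exact le_max_of_le_left (Real.rpow_le_rpow hK h hR)
  · exact le_max_of_le_right (Real.rpow_le_rpow hK h hR)

lemma le_of_forall_le_one_add_mul {a b : ℝ} (h : ∀ ε > 0, a ≤ (1 + ε) * b) : a ≤ b := by
  have hlim : Filter.Tendsto (fun ε : ℝ => (1 + ε) * b) (nhdsWithin 0 (Set.Ioi 0)) (nhds b) := by
    have : Continuous fun ε : ℝ => (1 + ε) * b := by fun_prop
    simpa using (this.tendsto 0).mono_left nhdsWithin_le_nhds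
  exact ge_of_tendsto hlim (by filter_upwards [self_mem_nhdsWithin] with ε hε using h ε hε)

end Scalar

/-! ### Scalar consequences of operator monotonicity, via multiples of the identity on a nonzero
space. -/

section OperatorMonotone

variable {H : Type u} [NormedAddCommGroup H] [InnerProductSpace ℂ H]

lemma ContinuousLinearMap.algebraMap_real_le_algebraMap [CompleteSpace H] [Nontrivial H] {a b : ℝ}
    (h : algebraMap ℝ (H →L[ℂ] H) a ≤ algebraMap ℝ (H →L[ℂ] H) b) : a ≤ b := by
  obtain ⟨x, hx⟩ := exists_ne (0 : H)
  have hx' : 0 < ‖x‖ ^ 2 := by positivity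
  have := reApplyInnerSelf_mono h x
  rw [Algebra.algebraMap_eq_smul_one, Algebra.algebraMap_eq_smul_one, reApplyInnerSelf_real_smul,
    reApplyInnerSelf_real_smul, reApplyInnerSelf_one] at this
  exact le_of_mul_le_mul_right this hx'

variable [CompleteSpace H] {f : ℝ → ℝ}

variable (H) in
lemma OperatorMonotone.monotoneOn [Nontrivial H] (hf : OperatorMonotone.{u} f) :
    MonotoneOn f (Set.Ioi 0) := by
  intro x hx y hy hxy
  have h := hf.2 H (algebraMap ℝ _ x) (algebraMap ℝ _ y) (isStrictlyPositive_algebraMap hx)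
    (isStrictlyPositive_algebraMap hy) (algebraMap_mono _ hxy)
  rw [cfc_algebraMap, cfc_algebraMap] at h
  exact algebraMap_real_le_algebraMap h

variable (H) in
lemma OperatorMonotone.add_le_apply [Nontrivial H] (hf : OperatorMonotone.{u} f) {x y μ ν ε : ℝ}
    (hx : 0 < x) (hy : 0 < y) (hμ : 0 < μ) (hν : 0 < ν) (hμν : μ + ν = 1) (hε : 0 < ε) :
    μ * f x + ν * f y ≤ f ((1 + ε) * (μ * x + ν * y)) := by
  have h := hf.smul_add_smul_le (H := H) (isStrictlyPositive_algebraMap (c := x) hx)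
    (isStrictlyPositive_algebraMap (c := y) hy) hμ hν hμν hε
  simp only [cfc_algebraMap, ← algebraMap.coe_smul] at h
  simp only [Algebra.smul_def, ← map_mul, ← map_add] at h
  rw [cfc_algebraMap] at h
  exact algebraMap_real_le_algebraMap h

variable (H) in
lemma OperatorMonotone.apply_mul_le [Nontrivial H] (hf : OperatorMonotone.{u} f)
    (hf_nonneg : ∀ x : ℝ, 0 < x → 0 ≤ f x) {c x : ℝ} (hc : 1 ≤ c) (hx : 0 < x) :
    f (c * x) ≤ c * f x := by
  have hc0 : 0 < c := by linarith
  have key : ∀ δ > 0, f (c * x) ≤ (1 + δ) * ((1 + δ) * (c * f x)) := by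
    intro δ hδ
    -- Slightly below 1/c, so that x = (1 + δ)(μ·cx + (1 - μ)y) has a solution y > 0; concavity and
    -- f(y) ≥ 0 then give μ f(cx) ≤ f(x).
    set μ : ℝ := 1 / (c * (1 + δ) ^ 2) with hμ_def
    have hμ : 0 < μ := by positivity
    have hμ1 : μ < 1 := by
      rw [hμ_def, div_lt_one (by positivity)]
      nlinarith
    have hν : 0 < 1 - μ := by linarith
    have hlt : 1 / (1 + δ) ^ 2 < 1 / (1 + δ) := by
      apply one_div_lt_one_div_of_lt (by positivity); nlinarith
    have hy : 0 < x * (1 / (1 + δ) - 1 / (1 + δ) ^ 2) / (1 - μ) :=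
      div_pos (mul_pos hx (by linarith)) hν
    have h := hf.add_le_apply H (mul_pos hc0 hx) hy hμ hν (by ring) hδ
    have hpt : (1 + δ) * (μ * (c * x) +
        (1 - μ) * (x * (1 / (1 + δ) - 1 / (1 + δ) ^ 2) / (1 - μ))) = x := by
      rw [mul_div_cancel₀ _ hν.ne', hμ_def]; field_simp; ring
    rw [hpt] at h
    have h2 : μ * f (c * x) ≤ f x := by
      have := mul_nonneg hν.le (hf_nonneg _ hy); linarith
    rw [hμ_def, one_div, inv_mul_le_iff₀ (by positivity)] at h2
    linarith
  have hnn : 0 ≤ c * f x := mul_nonneg hc0.le (hf_nonneg x hx)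
  refine le_of_forall_le_one_add_mul fun δ hδ => le_of_forall_le_one_add_mul fun δ' hδ' => ?_
  have hm : 0 < min δ δ' := lt_min hδ hδ'
  refine (key _ hm).trans ?_
  gcongr
  · exact min_le_right _ _
  · exact min_le_left _ _

variable (H) in
/-- A non-negative operator monotone function that vanishes somewhere vanishes identically. -/
lemma OperatorMonotone.eqOn_zero [Nontrivial H] (hf : OperatorMonotone.{u} f)
    (hf_nonneg : ∀ x : ℝ, 0 < x → 0 ≤ f x) {x : ℝ} (hx : 0 < x) (hfx : f x = 0) :
    Set.EqOn f 0 (Set.Ioi 0) := by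
  intro y hy
  refine le_antisymm ?_ (hf_nonneg y hy)
  rcases le_total y x with h | h
  · exact (hf.monotoneOn H hy hx h).trans hfx.le
  · have := hf.apply_mul_le H hf_nonneg ((one_le_div hx).2 h) hx
    rwa [div_mul_cancel₀ _ hx.ne', hfx, mul_zero] at this

lemma OperatorMonotone.cfc_smul_le [Nontrivial H] (hf : OperatorMonotone.{u} f)
    (hf_nonneg : ∀ x : ℝ, 0 < x → 0 ≤ f x) {X : H →L[ℂ] H} (hX : IsStrictlyPositive X) {c : ℝ}
    (hc : 1 ≤ c) : cfc f (c • X) ≤ c • cfc f X := by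
  have hc0 : 0 < c := by linarith
  have hmaps : Set.MapsTo (c * ·) (spectrum ℝ X) (Set.Ioi 0) :=
    fun x hx => mul_pos hc0 (hX.spectrum_pos hx)
  have hcont := hX.continuousOn_spectrum hf.1
  rw [← cfc_comp_const_mul c f X (hf.1.mono hmaps.image_subset) hX.isSelfAdjoint,
    ← cfc_const_mul c f X hcont]
  exact cfc_mono (fun x hx => hf.apply_mul_le H hf_nonneg hc (hX.spectrum_pos hx))
    (hf.1.comp (by fun_prop) hmaps) (by fun_prop)

end OperatorMonotone

/-! ### Operator arithmetic-geometric mean inequalities, by conjugation with A^{1/2}. -/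

section GeomMean

variable {H : Type*} [NormedAddCommGroup H] [InnerProductSpace ℂ H] [CompleteSpace H]
  {A B : H →L[ℂ] H}

lemma rpow_half_mul_rpow_half (hA : IsStrictlyPositive A) :
    A ^ (1 / 2 : ℝ) * A ^ (1 / 2 : ℝ) = A := by
  rw [← CFC.rpow_add hA.isUnit, add_halves, CFC.rpow_one A hA.nonneg]

lemma rpow_half_conj_rpow_neg_half (hA : IsStrictlyPositive A) (B : H →L[ℂ] H) :
    A ^ (1 / 2 : ℝ) * (A ^ (-(1 / 2) : ℝ) * B * A ^ (-(1 / 2) : ℝ)) * A ^ (1 / 2 : ℝ) = B := by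
  have h1 := CFC.rpow_mul_rpow_neg (1 / 2) hA
  have h2 := CFC.rpow_neg_mul_rpow (1 / 2) hA
  calc _ = (A ^ (1 / 2 : ℝ) * A ^ (-(1 / 2) : ℝ)) * B *
      (A ^ (-(1 / 2) : ℝ) * A ^ (1 / 2 : ℝ)) := by simp only [mul_assoc]
    _ = B := by rw [h1, h2, one_mul, mul_one]

lemma rpow_half_conj_arith (hA : IsStrictlyPositive A) (B : H →L[ℂ] H) (α : ℝ) :
    A ^ (1 / 2 : ℝ) * ((1 - α) • (1 : H →L[ℂ] H) +
      α • (A ^ (-(1 / 2) : ℝ) * B * A ^ (-(1 / 2) : ℝ))) * A ^ (1 / 2 : ℝ) =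
      (1 - α) • A + α • B := by
  rw [mul_add, add_mul, mul_smul_comm, smul_mul_assoc, mul_smul_comm, smul_mul_assoc, mul_one,
    rpow_half_mul_rpow_half hA, rpow_half_conj_rpow_neg_half hA]

lemma cfc_one_sub_add_mul {C : H →L[ℂ] H} (hC : IsSelfAdjoint C) (α : ℝ) :
    cfc (fun x : ℝ => (1 - α) + α * x) C = (1 - α) • (1 : H →L[ℂ] H) + α • C := by
  rw [cfc_const_add (1 - α) (fun x => α * x) C, cfc_const_mul_id α C,
    Algebra.algebraMap_eq_smul_one]

/-- The weighted arithmetic-geometric mean inequality for operators. -/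
lemma operatorGeomMean_le_arith (hA : IsStrictlyPositive A) (hB : 0 ≤ B) {α : ℝ} (hα0 : 0 ≤ α)
    (hα1 : α ≤ 1) : operatorGeomMean α A B ≤ (1 - α) • A + α • B := by
  have hC : 0 ≤ A ^ (-(1 / 2) : ℝ) * B * A ^ (-(1 / 2) : ℝ) :=
    conjugate_nonneg_of_nonneg hB CFC.rpow_nonneg
  rw [← rpow_half_conj_arith hA, operatorGeomMean]
  refine conjugate_le_conjugate_of_nonneg ?_ CFC.rpow_nonneg
  generalize A ^ (-(1 / 2) : ℝ) * B * A ^ (-(1 / 2) : ℝ) = C at hC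
  rw [← cfc_one_sub_add_mul (.of_nonneg hC), CFC.rpow_eq_cfc_real hC]
  refine cfc_mono (fun x hx => ?_) (Real.continuous_rpow_const hα0).continuousOn (by fun_prop)
  have := Real.geom_mean_le_arith_mean2_weighted (sub_nonneg.2 hα1) hα0 zero_le_one
    (spectrum_nonneg_of_nonneg hC hx) (by ring)
  simpa using this

/-- The reverse weighted arithmetic-geometric mean inequality for operators. -/
lemma arith_le_smul_operatorGeomMean (hA : IsStrictlyPositive A) {α s t : ℝ} (hα0 : 0 ≤ α)
    (hs : 0 < s) (hsAB : s • A ≤ B) (hBtA : B ≤ t • A) :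
    (1 - α) • A + α • B ≤
      max (kantorovich s ^ max (1 - α) α) (kantorovich t ^ max (1 - α) α) •
        operatorGeomMean α A B := by
  have hB : 0 ≤ B := (hA.smul hs).nonneg.trans hsAB
  have hconj : ∀ r : ℝ, A ^ (-(1 / 2) : ℝ) * (r • A) * A ^ (-(1 / 2) : ℝ) =
      algebraMap ℝ (H →L[ℂ] H) r := fun r => by
    rw [mul_smul_comm, smul_mul_assoc, CFC.conjugate_rpow_neg_one_half A hA,
      Algebra.algebraMap_eq_smul_one]
  have hA' : 0 ≤ A ^ (-(1 / 2) : ℝ) := CFC.rpow_nonneg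
  have hsC := conjugate_le_conjugate_of_nonneg hsAB hA'
  have hCt := conjugate_le_conjugate_of_nonneg hBtA hA'
  have hC : 0 ≤ A ^ (-(1 / 2) : ℝ) * B * A ^ (-(1 / 2) : ℝ) :=
    conjugate_nonneg_of_nonneg hB CFC.rpow_nonneg
  rw [hconj] at hsC hCt
  rw [← rpow_half_conj_arith hA, operatorGeomMean, ← smul_mul_assoc (max _ _),
    ← mul_smul_comm (max _ _)]
  refine conjugate_le_conjugate_of_nonneg ?_ CFC.rpow_nonneg
  generalize A ^ (-(1 / 2) : ℝ) * B * A ^ (-(1 / 2) : ℝ) = C at hC hsC hCt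
  have hcont : ContinuousOn (fun x : ℝ => x ^ α) (spectrum ℝ C) :=
    (Real.continuous_rpow_const hα0).continuousOn
  rw [← cfc_one_sub_add_mul (.of_nonneg hC), CFC.rpow_eq_cfc_real hC, ← cfc_const_mul _ _ C hcont]
  refine cfc_mono (fun x hx => ?_) (by fun_prop) (by fun_prop)
  exact add_mul_le_max_kantorovich_rpow_mul_rpow hs
    ((algebraMap_le_iff_le_spectrum (.of_nonneg hC)).1 hsC x hx)
    ((le_algebraMap_iff_spectrum_le (.of_nonneg hC)).1 hCt x hx)

lemma IsStrictlyPositive.operatorGeomMean (hA : IsStrictlyPositive A) (hB : IsStrictlyPositive B)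
    (α : ℝ) : IsStrictlyPositive (operatorGeomMean α A B) := by
  have hA' : ∀ r : ℝ, IsStrictlyPositive (A ^ r) := fun r => .rpow A r hA
  refine .conjugate_of_isUnit_of_isSelfAdjoint _ _ (hA' _).isUnit (hA' _).isSelfAdjoint
    (.rpow _ _ ?_)
  exact .conjugate_of_isUnit_of_isSelfAdjoint _ _ (hA' _).isUnit (hA' _).isSelfAdjoint hB

lemma operatorGeomMean_zero_left (α : ℝ) (B : H →L[ℂ] H) : operatorGeomMean α 0 B = 0 := by
  have : (0 : H →L[ℂ] H) ^ (1 / 2 : ℝ) = 0 := CFC.zero_rpow (by norm_num)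
  rw [operatorGeomMean, this, mul_zero]

end GeomMean

/-! ### The main estimate and the theorem. -/

lemma OperatorMonotone.isStrictlyPositive_cfc {H : Type u} [NormedAddCommGroup H]
    [InnerProductSpace ℂ H] [CompleteSpace H] {f : ℝ → ℝ} (hf : OperatorMonotone.{u} f)
    (hpos : ∀ x : ℝ, 0 < x → 0 < f x) {X : H →L[ℂ] H} (hX : IsStrictlyPositive X) :
    IsStrictlyPositive (cfc f X) := by
  refine IsUnit.isStrictlyPositive ?_ (cfc_nonneg fun x hx => (hpos x (hX.spectrum_pos hx)).le)
  exact (isUnit_cfc_iff f X (hX.continuousOn_spectrum hf.1) hX.isSelfAdjoint).2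
    fun x hx => (hpos x (hX.spectrum_pos hx)).ne'

/-- For a non-negative operator monotone `f`, the arithmetic mean of `f P` and `f Q` is dominated
by `c f(P ♯ Q)`, where `c` is the Kantorovich-type constant. -/
lemma OperatorMonotone.arith_cfc_le {H : Type u} [NormedAddCommGroup H]
    [InnerProductSpace ℂ H] [CompleteSpace H] [Nontrivial H] {f : ℝ → ℝ}
    (hf : OperatorMonotone.{u} f) (hf_nonneg : ∀ x : ℝ, 0 < x → 0 ≤ f x) {P Q : H →L[ℂ] H}
    (hP : IsStrictlyPositive P) {α s t : ℝ} (hα0 : 0 < α) (hα1 : α < 1) (hs : 0 < s)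
    (hsPQ : s • P ≤ Q) (hQtP : Q ≤ t • P) :
    (1 - α) • cfc f P + α • cfc f Q ≤
      max (kantorovich s ^ max (1 - α) α) (kantorovich t ^ max (1 - α) α) •
        cfc f (operatorGeomMean α P Q) := by
  set c := max (kantorovich s ^ max (1 - α) α) (kantorovich t ^ max (1 - α) α)
  have hc : 1 ≤ c := le_max_of_le_left
    (Real.one_le_rpow (one_le_kantorovich hs) (le_max_of_le_right hα0.le))
  have hQ : IsStrictlyPositive Q := (hP.smul hs).of_le hsPQ
  have hG := hP.operatorGeomMean hQ α
  have hα1' : 0 < 1 - α := sub_pos.2 hα1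
  have hX : IsStrictlyPositive ((1 - α) • P + α • Q) :=
    (hP.smul hα1').add_nonneg (hQ.smul hα0).nonneg
  have hF : IsSelfAdjoint (cfc f (operatorGeomMean α P Q)) := cfc_predicate _ _
  refine le_of_reApplyInnerSelf_le ?_ ((IsSelfAdjoint.all _).smul hF) fun x => ?_
  · exact ((IsSelfAdjoint.all _).smul (cfc_predicate _ _)).add
      ((IsSelfAdjoint.all _).smul (cfc_predicate _ _))
  -- Testing on a fixed vector turns the limit ε → 0 into one of real numbers.
  refine le_of_forall_le_one_add_mul fun ε hε => ?_
  have hε1 : 0 < 1 + ε := by linarith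
  have hle : (1 + ε) • ((1 - α) • P + α • Q) ≤ ((1 + ε) * c) • operatorGeomMean α P Q := by
    rw [mul_smul]
    exact smul_le_smul_of_nonneg_left
      (arith_le_smul_operatorGeomMean hP hα0.le hs hsPQ hQtP) hε1.le
  have h := calc (1 - α) • cfc f P + α • cfc f Q
    _ ≤ cfc f ((1 + ε) • ((1 - α) • P + α • Q)) :=
      hf.smul_add_smul_le hP hQ hα1' hα0 (by ring) hε
    _ ≤ cfc f (((1 + ε) * c) • operatorGeomMean α P Q) :=
      hf.2 H _ _ (hX.smul hε1) (hG.smul (by positivity)) hle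
    _ ≤ ((1 + ε) * c) • cfc f (operatorGeomMean α P Q) :=
      hf.cfc_smul_le hf_nonneg hG (by nlinarith)
  have := reApplyInnerSelf_mono h x
  rwa [mul_smul, reApplyInnerSelf_real_smul (1 + ε)] at this

theorem mainTheorem1 {H : Type u} [NormedAddCommGroup H] [InnerProductSpace ℂ H]
    [CompleteSpace H] (f : ℝ → ℝ) (hf : OperatorMonotone.{u} f)
    (hf_nonneg : ∀ x : ℝ, 0 < x → 0 ≤ f x)
    (p q : ℝ) (hp : 1 < p) (hq : 1 < q) (hpq : 1 / p + 1 / q = 1)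
    (A B : H →L[ℂ] H) (hA : 0 ≤ A) (hB : 0 ≤ B)
    (s t : ℝ) (hs : 0 < s) (hst : s ≤ t)
    (hsA : IsStrictlyPositive (s • A ^ p))
    (hsAB : s • A ^ p ≤ B ^ q) (hBtA : B ^ q ≤ t • A ^ p) :
    (1 / aczelConst p q s t) • operatorGeomMean (1 / q) (cfc f (A ^ p)) (cfc f (B ^ q)) ≤
        cfc f (operatorGeomMean (1 / q) (A ^ p) (B ^ q)) ∧
      ∀ x : H,
        (1 / aczelConst p q s t) *
            ((inner ℂ (cfc f (A ^ p) x) x).re ^ (1 / p) *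
              (inner ℂ (cfc f (B ^ q) x) x).re ^ (1 / q)) ≤
          (inner ℂ (cfc f (operatorGeomMean (1 / q) (A ^ p) (B ^ q)) x) x).re := by
  have hp0 : 0 < 1 / p := by positivity
  have hq0 : 0 < 1 / q := by positivity
  rcases subsingleton_or_nontrivial H with hH | hH
  · refine ⟨(Subsingleton.elim _ _).le, fun x => ?_⟩
    simp [Subsingleton.elim x 0, Real.zero_rpow (inv_ne_zero (by linarith : p ≠ 0))]
  have hP : IsStrictlyPositive (A ^ p) := by
    simpa [smul_smul, inv_mul_cancel₀ hs.ne'] using hsA.smul (inv_pos.2 hs)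
  have hQ : IsStrictlyPositive (B ^ q) := hsA.of_le hsAB
  generalize A ^ p = P at *
  generalize B ^ q = Q at *
  have hp' : 1 / p = 1 - 1 / q := by linarith
  have hc : 0 < aczelConst p q s t := lt_max_of_lt_left
    (Real.rpow_pos_of_pos (zero_lt_one.trans_le (one_le_kantorovich hs)) _)
  have hPf : 0 ≤ cfc f P := cfc_nonneg fun x hx => hf_nonneg x (hP.spectrum_pos hx)
  have hQf : 0 ≤ cfc f Q := cfc_nonneg fun x hx => hf_nonneg x (hQ.spectrum_pos hx)
  have hGf : 0 ≤ cfc f (operatorGeomMean (1 / q) P Q) :=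
    cfc_nonneg fun x hx => hf_nonneg x ((hP.operatorGeomMean hQ _).spectrum_pos hx)
  have key : (1 / p) • cfc f P + (1 / q) • cfc f Q ≤
      aczelConst p q s t • cfc f (operatorGeomMean (1 / q) P Q) := by
    rw [aczelConst, hp']
    exact hf.arith_cfc_le hf_nonneg hP hq0 (by linarith) hs hsAB hBtA
  refine ⟨?_, fun x => ?_⟩
  -- Operator AM-GM needs f(P) invertible. If f has a zero it vanishes identically on (0, ∞), and
  -- the mean is 0.
  · by_cases h0 : ∃ x : ℝ, 0 < x ∧ f x = 0
    · obtain ⟨x, hx, hfx⟩ := h0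
      have hP0 : cfc f P = 0 := by
        rw [cfc_congr ((hf.eqOn_zero H hf_nonneg hx hfx).mono fun y hy => hP.spectrum_pos hy),
          cfc_zero]
      rwa [hP0, operatorGeomMean_zero_left, smul_zero]
    · push Not at h0
      have hfP := hf.isStrictlyPositive_cfc
        (fun x hx => lt_of_le_of_ne (hf_nonneg x hx) (h0 x hx).symm) hP
      have h1 := operatorGeomMean_le_arith hfP hQf hq0.le (by linarith)
      rw [← hp'] at h1
      have h2 := smul_le_smul_of_nonneg_left (h1.trans key) (one_div_pos.2 hc).le
      rwa [smul_smul, one_div_mul_cancel hc.ne', one_smul] at h2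
  · have h1 := Real.geom_mean_le_arith_mean2_weighted hp0.le hq0.le
      (((nonneg_iff_isPositive _).1 hPf).2 x) (((nonneg_iff_isPositive _).1 hQf).2 x) hpq
    have h2 := reApplyInnerSelf_mono key x
    rw [reApplyInnerSelf_add, reApplyInnerSelf_real_smul, reApplyInnerSelf_real_smul,
      reApplyInnerSelf_real_smul] at h2
    rw [one_div_mul_eq_div, div_le_iff₀' hc]
    exact h1.trans h2
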